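/- A \emph{set system} $S=(E,\mathcal F)$ consists of a finite set $E$ (the ground set) and a collection $\mathcal F$ of subsets of $E$ (the feasible sets); it is \emph{proper} if $\mathcal F\neq\emptyset$. A \emph{delta-matroid} is a proper set system such that for all $X,Y\in\mathcal F$ and $u\in X\triangle Y$ there is $v\in X\triangle Y$ (possibly $v=u$) with $X\triangle\{u,v\}\in\mathcal F$. For $A\subseteq E$ the \emph{twist} is $S*A=(E,\{F\triangle A: F\in\mathcal F\})$, and for $e\in E$ the \emph{loop complementation} is $S+e=(E,\mathcal F\,\triangle\,\{F\cup\{e\}: e\notin F\in\mathcal F\})$. A \emph{twisted dual} of $S$ is a set system obtained from $S$ by a finite sequence of twists and loop complementations. Let $S$ be proper and $e\in E$. If some feasible set contains $e$, then $S/e=(E-\{e\},\{F-\{e\}: e\in F\in\mathcal F\})$; if some feasible set avoids $e$, then $S\backslash e=(E-\{e\},\{F\in\mathcal F: e\notin F\})$; if only one of these is defined in this way, the other is set equal to it. Put $S\ddagger e=(S+e)/e$. A \emph{$3$-minor} of $S$ is a set system obtained from $S$ by a finite (possibly empty) sequence of the operations $S\mapsto S\backslash e$, $S\mapsto S/e$,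 $S\mapsto S\ddagger e$. For a symmetric matrix $M$ over the two-element field with rows and columns indexed by $E$, let $D(M)$ be the set system on $E$ whose feasible sets are those $F\subseteq E$ for which the principal submatrix $M[F]$ is non-singular (the empty matrix being non-singular). A delta-matroid is \emph{binary} if it equals $D(M)*A$ for some such $M$ and some $A\subseteq E$. Let $$B_1=(\{a,b,c\},\{\emptyset,\{a,b\},\{a,c\},\{b,c\},\{a,b,c\}\}),\qquad S_3=(\{a,b,c\},\{\emptyset,\{a,b,c\}\}).$$ \textbf{Corollary.} A proper set system is a binary delta-matroid if and only if it has no $3$-minor that is isomorphic to a twisted dual of $B_1$ or of $S_3$. -/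

import Mathlib

/-- A set system `(E, 𝓕)`: a finite ground set `E` and a collection `𝓕` of subsets of `E`,
the feasible sets. -/
@[ext]
structure SetSystem (α : Type*) where
  ground : Finset α
  feasible : Finset (Finset α)
  subset_ground : ∀ F ∈ feasible, F ⊆ ground

namespace SetSystem

/-- A set system is proper if it has a feasible set. -/
def Proper {α : Type*} (S : SetSystem α) : Prop := S.feasible.Nonempty

/-- Isomorphism: a bijection of the ground sets under which feasible sets correspond. -/
def Iso {α β : Type*} (S : SetSystem α) (T : SetSystem β) : Prop :=
  ∃ f : S.ground ≃ T.ground, ∀ X : Finset S.ground,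
    X.map (Function.Embedding.subtype _) ∈ S.feasible ↔
      (X.map f.toEmbedding).map (Function.Embedding.subtype _) ∈ T.feasible

section Operations

variable {α : Type*} [DecidableEq α]

/-- A delta-matroid: a proper set system satisfying the symmetric exchange axiom. -/
def IsDeltaMatroid (S : SetSystem α) : Prop :=
  S.Proper ∧ ∀ X ∈ S.feasible, ∀ Y ∈ S.feasible, ∀ u ∈ symmDiff X Y,
    ∃ v ∈ symmDiff X Y, symmDiff X {u, v} ∈ S.feasible

/-- The twist `S * A`. It is only used for `A ⊆ E`, where `A ∩ E = A`. -/
def twist (S : SetSystem α) (A : Finset α) : SetSystem α where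
  ground := S.ground
  feasible := S.feasible.image fun F => symmDiff F (A ∩ S.ground)
  subset_ground := by
    intro F hF
    obtain ⟨G, hG, rfl⟩ := Finset.mem_image.1 hF
    intro x hx
    rcases Finset.mem_symmDiff.1 hx with h | h
    · exact S.subset_ground G hG h.1
    · exact (Finset.mem_inter.1 h.1).2

/-- The loop complementation `S + e = (E, 𝓕 ∆ {F ∪ e : e ∉ F ∈ 𝓕})`.
It is only used for `e ∈ E` (for `e ∉ E` it returns `S`). -/
def loopCompl (S : SetSystem α) (e : α) : SetSystem α where
  ground := S.ground
  feasible := symmDiff S.feasible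
    ((S.feasible.filter fun F => e ∈ S.ground ∧ e ∉ F).image fun F => insert e F)
  subset_ground := by
    intro F hF
    rcases Finset.mem_symmDiff.1 hF with h | h
    · exact S.subset_ground F h.1
    · obtain ⟨G, hG, rfl⟩ := Finset.mem_image.1 h.1
      have h2 := Finset.mem_filter.1 hG
      exact Finset.insert_subset h2.2.1 (S.subset_ground G h2.1)

/-- One twist, or one loop complementation on an element. -/
def TwistedDualStep (S T : SetSystem α) : Prop :=
  (∃ A ⊆ S.ground, T = S.twist A) ∨ ∃ e ∈ S.ground, T = S.loopCompl e

/-- `T` is a twisted dual of `S`: it is obtained from `S` by a finite sequence of twists and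
loop complementations. (The loop complementation on a set is, by definition, the composite of the
loop complementations on its elements.) -/
def IsTwistedDual (S T : SetSystem α) : Prop :=
  Relation.ReflTransGen TwistedDualStep S T

/-- `(E - e, {F - e : e ∈ F ∈ 𝓕})`, the contraction of `e` when `e` is not a loop. -/
def containing (S : SetSystem α) (e : α) : SetSystem α where
  ground := S.ground.erase e
  feasible := (S.feasible.filter fun F => e ∈ F).image fun F => F.erase e
  subset_ground := by
    intro F hF
    obtain ⟨G, hG, rfl⟩ := Finset.mem_image.1 hF
    exact Finset.erase_subset_erase e (S.subset_ground G (Finset.mem_filter.1 hG).1)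

/-- `(E - e, {F ∈ 𝓕 : e ∉ F})`, the deletion of `e` when `e` is not a coloop. -/
def avoiding (S : SetSystem α) (e : α) : SetSystem α where
  ground := S.ground.erase e
  feasible := S.feasible.filter fun F => e ∉ F
  subset_ground := by
    intro F hF
    have h := Finset.mem_filter.1 hF
    exact Finset.subset_erase.2 ⟨S.subset_ground F h.1, h.2⟩

/-- The contraction `S / e`; if `e` is a loop (in no feasible set) it is the deletion. -/
def contract (S : SetSystem α) (e : α) : SetSystem α :=
  if ∀ F ∈ S.feasible, e ∉ F then S.avoiding e else S.containing e

/-- The deletion `S \ e`; if `e` is a coloop (in every feasible set) it is the contraction. -/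
def delete (S : SetSystem α) (e : α) : SetSystem α :=
  if ∀ F ∈ S.feasible, e ∈ F then S.containing e else S.avoiding e

/-- The Penrose contraction `S ‡ e = (S + e) / e`. -/
def penrose (S : SetSystem α) (e : α) : SetSystem α := (S.loopCompl e).contract e

/-- One of the three minor operations, applied to one element of the ground set. -/
def ThreeMinorStep (S T : SetSystem α) : Prop :=
  ∃ e ∈ S.ground, T = S.delete e ∨ T = S.contract e ∨ T = S.penrose e

/-- `T` is a 3-minor of `S`: it is obtained from `S` by a finite sequence of deletions,
contractions and Penrose contractions. -/
def IsThreeMinor (S T : SetSystem α) : Prop :=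
  Relation.ReflTransGen ThreeMinorStep S T

/-- `D(M)`: the set system on `E` whose feasible sets are the `F ⊆ E` for which the principal
submatrix of `M` on the rows and columns in `F` is non-singular. -/
def ofMatrix (E : Finset α) (M : Matrix E E (ZMod 2)) : SetSystem α where
  ground := E
  feasible := (Finset.univ.filter fun F : Finset E =>
      (M.submatrix (fun i : F => (i : E)) (fun i : F => (i : E))).det ≠ 0).image
    fun F => F.map (Function.Embedding.subtype _)
  subset_ground := by
    intro F hF
    obtain ⟨G, _, rfl⟩ := Finset.mem_image.1 hF
    exact Finset.map_subtype_subset G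

/-- `S` is basic binary: `S = D(M)` for a symmetric matrix `M` over the field with two elements,
with rows and columns indexed by the ground set. -/
def IsBasicBinary (S : SetSystem α) : Prop :=
  ∃ M : Matrix S.ground S.ground (ZMod 2), M.IsSymm ∧ S = ofMatrix S.ground M

/-- A binary delta-matroid: a delta-matroid that is a twist of a basic binary one. -/
def IsBinaryDeltaMatroid (S : SetSystem α) : Prop :=
  S.IsDeltaMatroid ∧ ∃ D : SetSystem α, D.IsBasicBinary ∧ ∃ A ⊆ D.ground, S = D.twist A

end Operations

/-- `B₁ = ({a,b,c}, {∅, {a,b}, {a,c}, {b,c}, {a,b,c}})`. -/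
def B₁ : SetSystem (Fin 3) where
  ground := Finset.univ
  feasible := {∅, {0, 1}, {0, 2}, {1, 2}, {0, 1, 2}}
  subset_ground := fun F _ => Finset.subset_univ F

/-- `S₃ = ({a,b,c}, {∅, {a,b,c}})`. -/
def S₃ : SetSystem (Fin 3) where
  ground := Finset.univ
  feasible := {∅, {0, 1, 2}}
  subset_ground := fun F _ => Finset.subset_univ F

end SetSystem

/-!
Identify a set system on `E` with a function from the subsets of `E` to the field with two elements.
A twist by `e` and the loop complementation at `e` act as invertible linear maps on the tensor
factor belonging to `e`. The images under the three nonzero functionals on that factor are called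
slices below, and the 3-minors by one element of a proper set system are its nonzero slices.

Binary delta-matroids are exactly the proper set systems with a Lagrangian representation: a pair of
matrices `P`, `Q` with `P Qᵀ` symmetric such that `X` is feasible if and only if the columns of `Q`
in `X` together with those of `P` outside `X` form a non-singular matrix
(`isBinaryDeltaMatroid_iff`). If `∅` is feasible, then `P` is invertible and the symmetric matrix is
`P⁻¹ Q`. A twist exchanges columns of `P` and `Q`, and a loop complementation adds a column of `P`
to one of `Q`, so representability is preserved by twisted duality; it passes to 3-minors as well. It
fails for `B₁` and `S₃`, since a symmetric matrix of order three with zero diagonal over the field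
with two elements is singular (`HasLagrangianRep.notMem_three`).

Conversely, a matrix `M` is determined by the feasible sets of `D(M)` of size at most two. Suppose
that all slices of `S` are representable, that `∅` is feasible, and that `E` has at least four
elements. Comparing slices of `S` with those of `D(M)`, where `M` is read off from the small
feasible sets of `S`, gives `S = D(M)` (`SlicesRep.eq_of_card_le_two`). Hence a set system minimal among the
non-representable ones has at most three elements. Normalise it by twisted duality so that `∅` is
feasible and no singleton is. It then has exactly three elements and its ground set is feasible, and
the eight such set systems are twisted duals of `B₁` or `S₃` (`isTwistedDual_of_normalized`).
-/

namespace SetSystem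

/-! ### Feasible sets of the derived set systems -/

section Membership

variable {α : Type*} [DecidableEq α]

theorem mem_twist {S : SetSystem α} {A X : Finset α} :
    X ∈ (S.twist A).feasible ↔ symmDiff X (A ∩ S.ground) ∈ S.feasible := by
  simp only [twist, Finset.mem_image]
  constructor
  · rintro ⟨F, hF, rfl⟩
    rwa [symmDiff_symmDiff_cancel_right]
  · intro h
    exact ⟨_, h, symmDiff_symmDiff_cancel_right _ _⟩

theorem mem_loopCompl {S : SetSystem α} {e : α} {X : Finset α} (he : e ∈ S.ground) :
    X ∈ (S.loopCompl e).feasible ↔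
      Xor (X ∈ S.feasible) (e ∈ X ∧ X.erase e ∈ S.feasible) := by
  have key : X ∈ ((S.feasible.filter fun F => e ∈ S.ground ∧ e ∉ F).image fun F => insert e F) ↔
      e ∈ X ∧ X.erase e ∈ S.feasible := by
    simp only [Finset.mem_image, Finset.mem_filter]
    constructor
    · rintro ⟨F, ⟨hF, -, heF⟩, rfl⟩
      exact ⟨Finset.mem_insert_self _ _, by rwa [Finset.erase_insert heF]⟩
    · rintro ⟨h1, h2⟩
      exact ⟨_, ⟨h2, he, Finset.notMem_erase _ _⟩, Finset.insert_erase h1⟩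
  simp only [loopCompl, Finset.mem_symmDiff, key, xor_def]

theorem mem_avoiding {S : SetSystem α} {e : α} {X : Finset α} :
    X ∈ (S.avoiding e).feasible ↔ e ∉ X ∧ X ∈ S.feasible := by
  simp [avoiding, and_comm]

theorem mem_containing {S : SetSystem α} {e : α} {X : Finset α} :
    X ∈ (S.containing e).feasible ↔ e ∉ X ∧ insert e X ∈ S.feasible := by
  simp only [containing, Finset.mem_image, Finset.mem_filter]
  constructor
  · rintro ⟨F, ⟨hF, h⟩, rfl⟩
    exact ⟨Finset.notMem_erase _ _, by rwa [Finset.insert_erase h]⟩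
  · rintro ⟨h1, h2⟩
    exact ⟨_, ⟨h2, Finset.mem_insert_self _ _⟩, Finset.erase_insert h1⟩

theorem mem_containing_loopCompl {S : SetSystem α} {e : α} {X : Finset α} (he : e ∈ S.ground) :
    X ∈ ((S.loopCompl e).containing e).feasible ↔
      e ∉ X ∧ Xor (insert e X ∈ S.feasible) (X ∈ S.feasible) := by
  rw [mem_containing, mem_loopCompl he]
  refine and_congr_right fun h => ?_
  simp [Finset.erase_insert h]

theorem ext_feasible {S T : SetSystem α} (hg : S.ground = T.ground)
    (h : ∀ X ⊆ S.ground, X ∈ S.feasible ↔ X ∈ T.feasible) : S = T := by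
  refine SetSystem.ext hg (Finset.ext fun X => ?_)
  by_cases hX : X ⊆ S.ground
  · exact h X hX
  · exact iff_of_false (fun hX' => hX (S.subset_ground X hX'))
      fun hX' => hX (hg ▸ T.subset_ground X hX')

theorem twist_twist (S : SetSystem α) (A : Finset α) : (S.twist A).twist A = S := by
  refine ext_feasible rfl fun X _ => ?_
  rw [mem_twist, mem_twist]
  change symmDiff (symmDiff X (A ∩ S.ground)) (A ∩ S.ground) ∈ _ ↔ _
  rw [symmDiff_symmDiff_cancel_right]

theorem loopCompl_loopCompl (S : SetSystem α) {e : α} (he : e ∈ S.ground) :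
    (S.loopCompl e).loopCompl e = S := by
  refine ext_feasible rfl fun X _ => ?_
  have he' : e ∈ (S.loopCompl e).ground := he
  rw [mem_loopCompl he', mem_loopCompl he, mem_loopCompl he]
  simp only [xor_def, Finset.mem_erase, ne_eq, not_true_eq_false, false_and]
  tauto

theorem Proper.twist {S : SetSystem α} (h : S.Proper) (A : Finset α) : (S.twist A).Proper :=
  h.image _

theorem proper_twist_iff {S : SetSystem α} {A : Finset α} : (S.twist A).Proper ↔ S.Proper :=
  Finset.image_nonempty

theorem Proper.loopCompl {S : SetSystem α} (h : S.Proper) {e : α} (he : e ∈ S.ground) :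
    (S.loopCompl e).Proper := by
  obtain ⟨X, hX⟩ := h
  by_cases hc : e ∈ X ∧ X.erase e ∈ S.feasible
  · refine ⟨X.erase e, (mem_loopCompl he).2 (Or.inl ⟨hc.2, ?_⟩)⟩
    simp
  · exact ⟨X, (mem_loopCompl he).2 (Or.inl ⟨hX, hc⟩)⟩

theorem IsTwistedDual.symm {S T : SetSystem α} (h : S.IsTwistedDual T) : T.IsTwistedDual S := by
  have hsymm : Std.Symm (TwistedDualStep (α := α)) := ⟨?_⟩
  · exact Relation.ReflTransGen.stdSymm.symm _ _ h
  rintro S T (⟨A, hA, rfl⟩ | ⟨e, he, rfl⟩)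
  · exact Or.inl ⟨A, hA, (twist_twist S A).symm⟩
  · exact Or.inr ⟨e, he, (loopCompl_loopCompl S he).symm⟩

/-! ### Twists and slices -/

theorem insert_symmDiff_insert {e : α} {X B : Finset α} (hX : e ∉ X) (hB : e ∉ B) :
    symmDiff (insert e X) (insert e B) = symmDiff X B := by
  ext x
  by_cases hx : x = e
  · subst hx; simp [Finset.mem_symmDiff, hX, hB]
  · simp [Finset.mem_symmDiff, hx]

theorem symmDiff_insert {e : α} {X B : Finset α} (hX : e ∉ X) (hB : e ∉ B) :
    symmDiff X (insert e B) = insert e (symmDiff X B) := by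
  ext x
  by_cases hx : x = e
  · subst hx; simp [Finset.mem_symmDiff, hX]
  · simp [Finset.mem_symmDiff, hx]

theorem insert_symmDiff {e : α} {X B : Finset α} (hX : e ∉ X) (hB : e ∉ B) :
    symmDiff (insert e X) B = insert e (symmDiff X B) := by
  ext x
  by_cases hx : x = e
  · subst hx; simp [Finset.mem_symmDiff, hB]
  · simp [Finset.mem_symmDiff, hx]

theorem inter_erase_eq_of_notMem {e : α} {A E : Finset α} (h : e ∉ A) :
    A ∩ E.erase e = A ∩ E := by
  rw [Finset.inter_erase, Finset.erase_eq_of_notMem]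
  simp [h]

theorem insert_inter_erase {e : α} {A E : Finset α} (hA : e ∈ A) (hE : e ∈ E) :
    insert e (A ∩ E.erase e) = A ∩ E := by
  rw [Finset.inter_erase, Finset.insert_erase]
  simp [hA, hE]

theorem mem_twist_erase {S S' : SetSystem α} {e : α} {A X : Finset α}
    (hg : S'.ground = S.ground.erase e) :
    X ∈ (S'.twist A).feasible ↔ symmDiff X (A ∩ S.ground.erase e) ∈ S'.feasible := by
  rw [mem_twist, hg]

theorem notMem_symmDiff_erase {e : α} {A X E : Finset α} :
    e ∉ symmDiff X (A ∩ E.erase e) ↔ e ∉ X := by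
  simp [Finset.mem_symmDiff]

theorem avoiding_twist_of_notMem {S : SetSystem α} {e : α} {A : Finset α} (h : e ∉ A) :
    (S.twist A).avoiding e = (S.avoiding e).twist A := by
  refine ext_feasible rfl fun X _ => ?_
  rw [mem_twist_erase (S := S) (e := e) rfl, mem_avoiding, mem_avoiding, mem_twist,
    notMem_symmDiff_erase, inter_erase_eq_of_notMem h]

theorem avoiding_twist_of_mem {S : SetSystem α} {e : α} {A : Finset α} (h : e ∈ A)
    (he : e ∈ S.ground) : (S.twist A).avoiding e = (S.containing e).twist A := by
  refine ext_feasible rfl fun X _ => ?_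
  rw [mem_twist_erase (S := S) (e := e) rfl, mem_avoiding, mem_containing, mem_twist,
    notMem_symmDiff_erase, ← insert_inter_erase h he]
  refine and_congr_right fun hX => ?_
  rw [symmDiff_insert hX (by simp)]

theorem containing_twist_of_notMem {S : SetSystem α} {e : α} {A : Finset α} (h : e ∉ A) :
    (S.twist A).containing e = (S.containing e).twist A := by
  refine ext_feasible rfl fun X _ => ?_
  rw [mem_twist_erase (S := S) (e := e) rfl, mem_containing, mem_containing, mem_twist,
    notMem_symmDiff_erase, inter_erase_eq_of_notMem h]
  refine and_congr_right fun hX => ?_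
  rw [insert_symmDiff hX (by simp [h])]

theorem containing_twist_of_mem {S : SetSystem α} {e : α} {A : Finset α} (h : e ∈ A)
    (he : e ∈ S.ground) : (S.twist A).containing e = (S.avoiding e).twist A := by
  refine ext_feasible rfl fun X _ => ?_
  rw [mem_twist_erase (S := S) (e := e) rfl, mem_avoiding, mem_containing, mem_twist,
    notMem_symmDiff_erase, ← insert_inter_erase h he]
  refine and_congr_right fun hX => ?_
  rw [insert_symmDiff_insert hX (by simp)]

/-- The third slice commutes with all twists: it records the parity of the number of feasible sets
among `X` and `X ∪ {e}`, which a twist by `e` does not affect. -/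
theorem containing_loopCompl_twist {S : SetSystem α} {e : α} {A : Finset α}
    (he : e ∈ S.ground) : ((S.twist A).loopCompl e).containing e =
      ((S.loopCompl e).containing e).twist A := by
  refine ext_feasible rfl fun X _ => ?_
  rw [mem_twist_erase (S := S) (e := e) rfl, mem_containing_loopCompl he,
    mem_containing_loopCompl (S := S.twist A) he, mem_twist, mem_twist, notMem_symmDiff_erase]
  refine and_congr_right fun hX => ?_
  by_cases h : e ∈ A
  · rw [← insert_inter_erase h he, insert_symmDiff_insert hX (by simp),
      symmDiff_insert hX (by simp), xor_comm]
  · rw [inter_erase_eq_of_notMem h, insert_symmDiff hX (by simp [h])]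

end Membership


/-! ### Lagrangian representations -/

section Lagrangian

variable {α : Type*} [DecidableEq α]

/-- The matrix whose column `j` is that of `Q` if `j ∈ X` and that of `P` otherwise. -/
def chooseCols {E : Finset α} (P Q : Matrix E E (ZMod 2)) (X : Finset α) :
    Matrix E E (ZMod 2) :=
  Matrix.of fun i j => if (j : α) ∈ X then Q i j else P i j

/-- A pair `P`, `Q` of square matrices over the field with two elements with `P Qᵀ` symmetric
represents `S` if the feasible sets are the `X ⊆ E` for which the columns of `Q` in `X` together
with those of `P` outside `X` form a non-singular matrix. The symmetry of `P Qᵀ` is written as the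
vanishing of `P Qᵀ + Q Pᵀ`. -/
def HasLagrangianRep (S : SetSystem α) : Prop :=
  ∃ P Q : Matrix S.ground S.ground (ZMod 2),
    (∀ i k, ∑ j, (P i j * Q k j + P k j * Q i j) = 0) ∧
    ∀ X ⊆ S.ground, X ∈ S.feasible ↔ (chooseCols P Q X).det ≠ 0

/-- A twist interchanges columns of `P` and `Q`. -/
theorem HasLagrangianRep.twist {S : SetSystem α} (h : S.HasLagrangianRep) (A : Finset α) :
    (S.twist A).HasLagrangianRep := by
  obtain ⟨P, Q, hPQ, hS⟩ := h
  refine ⟨chooseCols P Q A, chooseCols Q P A, fun i k => ?_, fun X hX => ?_⟩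
  · rw [← hPQ i k]
    refine Finset.sum_congr rfl fun j _ => ?_
    simp only [chooseCols, Matrix.of_apply]
    split_ifs <;> ring
  · have hX' : X ⊆ S.ground := hX
    rw [mem_twist, hS]
    · have : chooseCols P Q (symmDiff X (A ∩ S.ground)) =
          chooseCols (chooseCols P Q A) (chooseCols Q P A) X := by
        ext i j
        have hj := j.2
        by_cases h1 : (j : α) ∈ X <;> by_cases h2 : (j : α) ∈ A <;>
          simp [chooseCols, Finset.mem_symmDiff, h1, h2]
      rw [this]
      rfl
    · intro x hx
      rcases Finset.mem_symmDiff.1 hx with h | h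
      · exact hX' h.1
      · exact (Finset.mem_inter.1 h.1).2

/-- A loop complementation at `e` adds column `e` of `P` to column `e` of `Q`. -/
theorem HasLagrangianRep.loopCompl {S : SetSystem α} (h : S.HasLagrangianRep) {e : α}
    (he : e ∈ S.ground) : (S.loopCompl e).HasLagrangianRep := by
  obtain ⟨P, Q, hPQ, hS⟩ := h
  refine ⟨P, Matrix.of fun i j => if (j : α) = e then Q i j + P i j else Q i j,
    fun i k => ?_, fun X hX => ?_⟩
  · rw [← hPQ i k]
    refine Finset.sum_congr rfl fun j _ => ?_
    simp only [Matrix.of_apply]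
    split_ifs
    · generalize P i j = a, Q i j = b, P k j = c, Q k j = d
      decide +revert
    · rfl
  · have hX' : X ⊆ S.ground := hX
    rw [mem_loopCompl he, hS X hX', hS (X.erase e) ((Finset.erase_subset _ _).trans hX')]
    by_cases heX : e ∈ X
    · have key : (chooseCols P
          (Matrix.of fun i j => if (j : α) = e then Q i j + P i j else Q i j) X).det =
          (chooseCols P Q X).det + (chooseCols P Q (X.erase e)).det := by
        have h1 : chooseCols P
            (Matrix.of fun i j => if (j : α) = e then Q i j + P i j else Q i j) X =
            (chooseCols P Q X).updateCol ⟨e, he⟩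
              ((fun i => Q i ⟨e, he⟩) + fun i => P i ⟨e, he⟩) := by
          ext i j
          by_cases hj : j = ⟨e, he⟩
          · subst hj; simp [chooseCols, heX]
          · have : (j : α) ≠ e := fun h => hj (Subtype.ext h)
            simp [chooseCols, this, hj]
        have h2 : chooseCols P Q X =
            (chooseCols P Q X).updateCol ⟨e, he⟩ (fun i => Q i ⟨e, he⟩) := by
          ext i j
          by_cases hj : j = ⟨e, he⟩
          · subst hj; simp [chooseCols, heX]
          · simp [hj]
        have h3 : chooseCols P Q (X.erase e) =
            (chooseCols P Q X).updateCol ⟨e, he⟩ (fun i => P i ⟨e, he⟩) := by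
          ext i j
          by_cases hj : j = ⟨e, he⟩
          · subst hj; simp [chooseCols]
          · have : (j : α) ≠ e := fun h => hj (Subtype.ext h)
            simp [chooseCols, this, hj]
        rw [h1, Matrix.det_updateCol_add, ← h2, ← h3]
      refine Iff.trans ?_ (not_congr (iff_of_eq (congrArg (· = 0) key.symm)))
      simp only [heX, true_and]
      generalize (chooseCols P Q X).det = a, (chooseCols P Q (X.erase e)).det = b
      decide +revert
    · have : chooseCols P Q X = chooseCols P
          (Matrix.of fun i j => if (j : α) = e then Q i j + P i j else Q i j) X := by
        ext i j
        by_cases hj : (j : α) = e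
        · simp [chooseCols, hj, heX]
        · simp [chooseCols, hj]
      simp only [heX, false_and, this, xor_def, not_false_eq_true, and_true, or_false]
      rfl

theorem HasLagrangianRep.of_isTwistedDual {S T : SetSystem α} (h : S.HasLagrangianRep)
    (hST : S.IsTwistedDual T) : T.HasLagrangianRep := by
  induction hST with
  | refl => exact h
  | tail _ hstep ih =>
    rcases hstep with ⟨A, -, rfl⟩ | ⟨e, he, rfl⟩
    · exact ih.twist A
    · exact ih.loopCompl he

/-! ### Principal minors -/

/-- The determinant of the principal submatrix of `M` on `X`. -/
def principalMinor {ι : Type*} [DecidableEq ι] (M : Matrix ι ι (ZMod 2)) (X : Finset ι) : ZMod 2 :=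
  (M.submatrix (Subtype.val : X → ι) Subtype.val).det

/-- The feasible sets of `S` are given by the principal minors of `M`; the entries of `M` outside
the ground set are irrelevant. -/
def IsPrincipalRep (S : SetSystem α) (M : Matrix α α (ZMod 2)) : Prop :=
  M.IsSymm ∧ ∀ X ⊆ S.ground, X ∈ S.feasible ↔ principalMinor M X ≠ 0

/-- A principal minor can be computed along any enumeration of its index set. -/
theorem principalMinor_map {ι κ : Type*} [DecidableEq ι] [DecidableEq κ] [Fintype κ]
    (M : Matrix ι ι (ZMod 2)) (X : Finset ι) (e : κ ≃ X) (v : κ → ι) (hv : ∀ k, v k = e k) :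
    principalMinor M X = (M.submatrix v v).det := by
  obtain rfl : v = fun k => (e k : ι) := funext hv
  rw [principalMinor, ← Matrix.det_submatrix_equiv_self e]
  rfl

theorem principalMinor_of_map {κ : Type*} [DecidableEq κ] [Fintype κ]
    (M : Matrix α α (ZMod 2)) (v : κ ↪ α) :
    principalMinor M (Finset.univ.map v) = (M.submatrix v v).det := by
  refine principalMinor_map M _
    (Equiv.ofBijective (fun k => ⟨v k, Finset.mem_map_of_mem v (Finset.mem_univ k)⟩) ⟨?_, ?_⟩) v
    fun _ => rfl
  · intro a b hab
    exact v.injective (congrArg Subtype.val hab)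
  · rintro ⟨x, hx⟩
    obtain ⟨k, -, rfl⟩ := Finset.mem_map.1 hx
    exact ⟨k, rfl⟩

theorem principalMinor_empty (M : Matrix α α (ZMod 2)) : principalMinor M ∅ = 1 :=
  Matrix.det_isEmpty

theorem principalMinor_singleton (M : Matrix α α (ZMod 2)) (i : α) :
    principalMinor M {i} = M i i := by
  rw [principalMinor, Matrix.det_unique]
  rfl

theorem principalMinor_pair (M : Matrix α α (ZMod 2)) {i j : α} (h : i ≠ j) :
    principalMinor M {i, j} = M i i * M j j - M i j * M j i := by
  have hv : Function.Injective ![i, j] := by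
    intro a b
    fin_cases a <;> fin_cases b <;> simp [h, h.symm]
  have := principalMinor_of_map M ⟨![i, j], hv⟩
  rw [Matrix.det_fin_two] at this
  have hset : ({i, j} : Finset α) = Finset.univ.map ⟨![i, j], hv⟩ := by
    ext x
    simp [eq_comm]
  rw [hset, this]
  rfl

theorem principalMinor_congr {M N : Matrix α α (ZMod 2)} {X : Finset α}
    (h : ∀ i ∈ X, ∀ j ∈ X, M i j = N i j) : principalMinor M X = principalMinor N X := by
  unfold principalMinor
  congr 1
  ext i j
  exact h i i.2 j j.2

/-- Over the field with two elements, a symmetric matrix of order three with zero diagonal is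
singular. -/
theorem principalMinor_three {M : Matrix α α (ZMod 2)} (hM : M.IsSymm) (v : Fin 3 ↪ α)
    (h0 : ∀ i, M (v i) (v i) = 0) : principalMinor M (Finset.univ.map v) = 0 := by
  rw [principalMinor_of_map, Matrix.det_fin_three]
  simp only [Matrix.submatrix_apply, h0, hM.apply (v 0) (v 1), hM.apply (v 0) (v 2),
    hM.apply (v 1) (v 2)]
  generalize M (v 0) (v 1) = a, M (v 0) (v 2) = b, M (v 1) (v 2) = c
  decide +revert

/-- If `P = 1`, the chosen columns form a block triangular matrix with the principal submatrix on
`X` as its only nontrivial diagonal block. -/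
theorem det_chooseCols_one {E : Finset α} (N : Matrix E E (ZMod 2)) (M : Matrix α α (ZMod 2))
    (hNM : ∀ i j, N i j = M i j) {X : Finset α} (hX : X ⊆ E) :
    (chooseCols 1 N X).det = principalMinor M X := by
  rw [Matrix.twoBlockTriangular_det (chooseCols 1 N X) (fun j => (j : α) ∉ X)]
  · have h1 : Matrix.toSquareBlockProp (chooseCols 1 N X) (fun j => (j : α) ∉ X) = 1 := by
      ext i j
      have hj : (j.1 : α) ∉ X := j.2
      by_cases hij : i = j
      · subst hij
        simp [Matrix.toSquareBlockProp, chooseCols, hj]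
      · have hij' : i.1 ≠ j.1 := fun h => hij (Subtype.ext h)
        simp [Matrix.toSquareBlockProp, chooseCols, hj, hij, hij']
    rw [h1, Matrix.det_one, one_mul]
    symm
    rw [principalMinor_map M X (κ := {j : E // ¬ (j : α) ∉ X})
      ⟨fun j => ⟨j.1, not_not.1 j.2⟩, fun x => ⟨⟨x, hX x.2⟩, not_not.2 x.2⟩,
        fun _ => rfl, fun _ => rfl⟩ (fun j => j.1) fun _ => rfl]
    congr 1
    ext i j
    have := j.2
    simp only [not_not] at this
    simp [Matrix.toSquareBlockProp, chooseCols, this, hNM]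
  · intro i hi j hj
    have hij : i ≠ j := fun h => hi (h ▸ hj)
    simp [chooseCols, hj, hij]

end Lagrangian

/-! ### Representable set systems are binary delta-matroids -/

section Binary

open scoped Matrix

variable {α : Type*} [DecidableEq α]

/-- Extension of a matrix on `E` by zero. -/
def extendZero {E : Finset α} (N : Matrix E E (ZMod 2)) : Matrix α α (ZMod 2) :=
  Matrix.of fun i j => if h : i ∈ E ∧ j ∈ E then N ⟨i, h.1⟩ ⟨j, h.2⟩ else 0

theorem extendZero_apply {E : Finset α} (N : Matrix E E (ZMod 2)) (i j : E) :
    N i j = extendZero N i j := by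
  simp [extendZero]

theorem extendZero_isSymm {E : Finset α} {N : Matrix E E (ZMod 2)} (hN : N.IsSymm) :
    (extendZero N).IsSymm := by
  ext i j
  simp only [extendZero, Matrix.transpose_apply, Matrix.of_apply, and_comm (a := j ∈ E)]
  split_ifs
  · exact hN.apply _ _
  · rfl

theorem IsPrincipalRep.hasLagrangianRep {S : SetSystem α} {M : Matrix α α (ZMod 2)}
    (h : S.IsPrincipalRep M) : S.HasLagrangianRep := by
  refine ⟨1, M.submatrix Subtype.val Subtype.val, fun i k => ?_, fun X hX => ?_⟩
  · simp only [Finset.sum_add_distrib, Matrix.one_apply, ite_mul, one_mul, zero_mul,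
      Finset.sum_ite_eq, Finset.mem_univ, if_true, Matrix.submatrix_apply]
    rw [h.1.apply (k : α) i]
    exact CharTwo.add_self_eq_zero _
  · rw [h.2 X hX, det_chooseCols_one (M.submatrix Subtype.val Subtype.val) M (fun _ _ => rfl) hX]

/-- If the empty set is feasible, then `P` is invertible, and `P⁻¹ Q` is the symmetric matrix. -/
theorem HasLagrangianRep.exists_isPrincipalRep {S : SetSystem α} (h : S.HasLagrangianRep)
    (h0 : ∅ ∈ S.feasible) : ∃ M, S.IsPrincipalRep M := by
  obtain ⟨P, Q, hPQ, hS⟩ := h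
  have hP : P.det ≠ 0 := by
    have := (hS ∅ (Finset.empty_subset _)).1 h0
    rwa [show chooseCols P Q ∅ = P by ext; simp [chooseCols]] at this
  have hPu : IsUnit P.det := hP.isUnit
  have hsymm : P * Qᵀ = Q * Pᵀ := by
    ext i k
    have := hPQ i k
    rw [Finset.sum_add_distrib, CharTwo.add_eq_zero] at this
    simp only [Matrix.mul_apply, Matrix.transpose_apply]
    rw [this]
    exact Finset.sum_congr rfl fun _ _ => mul_comm _ _
  have hN : (P⁻¹ * Q).IsSymm := by
    have hPt : IsUnit (Pᵀ).det := by rwa [Matrix.det_transpose]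
    rw [Matrix.IsSymm, Matrix.transpose_mul, Matrix.transpose_nonsing_inv]
    calc Qᵀ * Pᵀ⁻¹ = P⁻¹ * (P * Qᵀ) * Pᵀ⁻¹ := by
          rw [Matrix.nonsing_inv_mul_cancel_left _ _ hPu]
      _ = P⁻¹ * Q := by
          rw [hsymm, ← Matrix.mul_assoc, Matrix.mul_nonsing_inv_cancel_right _ _ hPt]
  refine ⟨extendZero (P⁻¹ * Q), extendZero_isSymm hN, fun X hX => ?_⟩
  have hfac : chooseCols P Q X = P * chooseCols 1 (P⁻¹ * Q) X := by
    ext i j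
    have h2 : Q i j = (P * (P⁻¹ * Q)) i j := by
      rw [Matrix.mul_nonsing_inv_cancel_left _ _ hPu]
    have h1 : P i j = (P * (1 : Matrix S.ground S.ground (ZMod 2))) i j := by rw [Matrix.mul_one]
    by_cases hj : (j : α) ∈ X
    · simp only [chooseCols, Matrix.of_apply, hj, if_true, Matrix.mul_apply] at h2 ⊢
      exact h2
    · simp only [chooseCols, Matrix.of_apply, hj, if_false, Matrix.mul_apply] at h1 ⊢
      exact h1
  rw [hS X hX, hfac, Matrix.det_mul,
    det_chooseCols_one _ (extendZero (P⁻¹ * Q)) (extendZero_apply _) hX]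
  simp [hP]

theorem mem_ofMatrix {E : Finset α} {N : Matrix E E (ZMod 2)} {M : Matrix α α (ZMod 2)}
    (hNM : ∀ i j, N i j = M i j) {X : Finset α} (hX : X ⊆ E) :
    X ∈ (ofMatrix E N).feasible ↔ principalMinor M X ≠ 0 := by
  have key : ∀ F : Finset E, (N.submatrix (fun i : F => (i : E)) (fun i : F => (i : E))).det =
      principalMinor M (F.map (Function.Embedding.subtype _)) := by
    intro F
    have hF : F.map (Function.Embedding.subtype _) = Finset.univ.map
        ((Function.Embedding.subtype (· ∈ F)).trans (Function.Embedding.subtype (· ∈ E))) := by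
      ext x
      simp
    rw [hF, principalMinor_of_map]
    congr 1
    ext i j
    exact hNM _ _
  simp only [ofMatrix, Finset.mem_image, Finset.mem_filter, Finset.mem_univ, true_and, key]
  constructor
  · rintro ⟨F, hF, rfl⟩
    exact hF
  · intro h
    have := Finset.subtype_map_of_mem (p := (· ∈ E)) (s := X) fun x hx => hX hx
    exact ⟨X.subtype (· ∈ E), this.symm ▸ h, this⟩

theorem IsBasicBinary.exists_isPrincipalRep {S : SetSystem α} (h : S.IsBasicBinary) :
    ∃ M, S.IsPrincipalRep M := by
  obtain ⟨N, hN, hS⟩ := h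
  refine ⟨extendZero N, extendZero_isSymm hN, fun X hX => ?_⟩
  rw [← mem_ofMatrix (extendZero_apply N) hX, ← hS]

theorem IsPrincipalRep.isBasicBinary {S : SetSystem α} {M : Matrix α α (ZMod 2)}
    (h : S.IsPrincipalRep M) : S.IsBasicBinary := by
  refine ⟨M.submatrix Subtype.val Subtype.val, ?_, ext_feasible rfl fun X hX => ?_⟩
  · ext i j
    exact h.1.apply _ _
  · rw [mem_ofMatrix (N := M.submatrix Subtype.val Subtype.val) (M := M) (fun _ _ => rfl) hX,
      h.2 X hX]

theorem empty_mem_twist {S : SetSystem α} {A : Finset α} (hA : A ∈ S.feasible) :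
    ∅ ∈ (S.twist A).feasible := by
  rw [mem_twist, Finset.inter_eq_left.2 (S.subset_ground A hA), ← Finset.bot_eq_empty,
    bot_symmDiff]
  exact hA

/-- Twisting by `X` reduces exchange to the case `X = ∅`: row `u` of the non-singular principal
submatrix on `X ∆ Y` has a nonzero entry, which gives a non-singular principal submatrix of order
one or two containing `u`. -/
theorem HasLagrangianRep.isDeltaMatroid {S : SetSystem α} (h : S.HasLagrangianRep)
    (hS : S.Proper) : S.IsDeltaMatroid := by
  refine ⟨hS, fun X hX Y hY u hu => ?_⟩
  have hXE := S.subset_ground X hX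
  have hYE := S.subset_ground Y hY
  have hXX : X ∩ S.ground = X := Finset.inter_eq_left.2 hXE
  obtain ⟨M, hM, hrep⟩ := (h.twist X).exists_isPrincipalRep (empty_mem_twist hX)
  have hDE : symmDiff X Y ⊆ S.ground := fun x hx => by
    rcases Finset.mem_symmDiff.1 hx with h | h
    exacts [hXE h.1, hYE h.1]
  have hmem : ∀ Z ⊆ S.ground, symmDiff X Z ∈ S.feasible ↔ principalMinor M Z ≠ 0 := by
    intro Z hZ
    rw [← hrep Z hZ, mem_twist, hXX, symmDiff_comm]
  have hD : principalMinor M (symmDiff X Y) ≠ 0 := by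
    rw [← hmem _ hDE, symmDiff_symmDiff_cancel_left]
    exact hY
  obtain ⟨v, hv, huv⟩ : ∃ v ∈ symmDiff X Y, M u v ≠ 0 := by
    by_contra! hcon
    exact hD (Matrix.det_eq_zero_of_row_eq_zero ⟨u, hu⟩ fun j => hcon j j.2)
  by_cases huu : M u u = 0
  · have hne : u ≠ v := fun h => huv (h ▸ huu)
    refine ⟨v, hv, (hmem _ ?_).2 ?_⟩
    · simp [Finset.insert_subset_iff, hDE hu, hDE hv]
    · rw [principalMinor_pair M hne, huu, zero_mul, zero_sub, neg_ne_zero, hM.apply u v]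
      exact mul_ne_zero huv huv
  · refine ⟨u, hu, (hmem _ ?_).2 ?_⟩
    · simp [hDE hu]
    · rwa [Finset.pair_eq_singleton, principalMinor_singleton]

/-- Lagrangian representations characterise binary delta-matroids among proper set systems: a twist
by a feasible set makes the empty set feasible, hence the set system basic binary. -/
theorem isBinaryDeltaMatroid_iff {S : SetSystem α} (hS : S.Proper) :
    S.IsBinaryDeltaMatroid ↔ S.HasLagrangianRep := by
  constructor
  · rintro ⟨-, D, hD, A, -, rfl⟩
    obtain ⟨M, hM⟩ := hD.exists_isPrincipalRep
    exact hM.hasLagrangianRep.twist A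
  · intro h
    obtain ⟨A, hA⟩ := id hS
    obtain ⟨M, hM⟩ := (h.twist A).exists_isPrincipalRep (empty_mem_twist hA)
    exact ⟨h.isDeltaMatroid hS, _, hM.isBasicBinary, A, S.subset_ground A hA,
      (twist_twist S A).symm⟩

/-! ### Slices and 3-minors of representable set systems -/

/-- Twisting by a feasible set that avoids `e` does not interfere with the slice at `e`, and turns
the slice into the restriction of a symmetric matrix. -/
theorem HasLagrangianRep.avoiding {S : SetSystem α} (h : S.HasLagrangianRep) {e : α}
    (hp : (S.avoiding e).Proper) : (S.avoiding e).HasLagrangianRep := by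
  obtain ⟨A, hA⟩ := hp
  rw [mem_avoiding] at hA
  obtain ⟨M, hM, hrep⟩ := (h.twist A).exists_isPrincipalRep (empty_mem_twist hA.2)
  have hM' : ((S.twist A).avoiding e).IsPrincipalRep M := by
    refine ⟨hM, fun X hX => ?_⟩
    have hX' := Finset.subset_erase.1 hX
    rw [mem_avoiding, ← hrep X hX'.1]
    exact and_iff_right hX'.2
  have := hM'.hasLagrangianRep.twist A
  rwa [avoiding_twist_of_notMem hA.1, twist_twist] at this

theorem HasLagrangianRep.containing {S : SetSystem α} (h : S.HasLagrangianRep) {e : α}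
    (he : e ∈ S.ground) (hp : (S.containing e).Proper) : (S.containing e).HasLagrangianRep := by
  have heq := avoiding_twist_of_mem (S := S) (Finset.mem_singleton_self e) he
  have hp' : ((S.twist {e}).avoiding e).Proper := heq ▸ hp.twist {e}
  have := ((h.twist {e}).avoiding hp').twist {e}
  rwa [heq, twist_twist] at this

theorem avoiding_proper {S : SetSystem α} {e : α} :
    (S.avoiding e).Proper ↔ ¬ ∀ F ∈ S.feasible, e ∈ F := by
  simp only [Proper, Finset.Nonempty, mem_avoiding]
  push Not
  exact exists_congr fun _ => and_comm

theorem containing_proper {S : SetSystem α} {e : α} :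
    (S.containing e).Proper ↔ ¬ ∀ F ∈ S.feasible, e ∉ F := by
  simp only [Proper, Finset.Nonempty, mem_containing]
  push Not
  constructor
  · rintro ⟨X, -, hX⟩
    exact ⟨_, hX, Finset.mem_insert_self _ _⟩
  · rintro ⟨X, hX, he⟩
    exact ⟨X.erase e, Finset.notMem_erase _ _, by rwa [Finset.insert_erase he]⟩

theorem avoiding_proper_or_containing_proper {S : SetSystem α} (hS : S.Proper) (e : α) :
    (S.avoiding e).Proper ∨ (S.containing e).Proper := by
  rw [avoiding_proper, containing_proper, ← not_and_or]
  rintro ⟨h1, h2⟩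
  obtain ⟨X, hX⟩ := hS
  exact h2 X hX (h1 X hX)

theorem delete_eq_of_proper {S : SetSystem α} {e : α} (h : (S.avoiding e).Proper) :
    S.delete e = S.avoiding e := if_neg (avoiding_proper.1 h)

theorem contract_eq_of_proper {S : SetSystem α} {e : α} (h : (S.containing e).Proper) :
    S.contract e = S.containing e := if_neg (containing_proper.1 h)

theorem delete_spec {S : SetSystem α} (hS : S.Proper) (e : α) :
    (S.delete e).Proper ∧ (S.delete e = S.avoiding e ∨ S.delete e = S.containing e) := by
  by_cases h : (S.avoiding e).Proper
  · rw [delete_eq_of_proper h]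
    exact ⟨h, Or.inl rfl⟩
  · have : S.delete e = S.containing e := if_pos (not_not.1 (mt avoiding_proper.2 h))
    rw [this]
    exact ⟨(avoiding_proper_or_containing_proper hS e).resolve_left h, Or.inr rfl⟩

theorem contract_spec {S : SetSystem α} (hS : S.Proper) (e : α) :
    (S.contract e).Proper ∧ (S.contract e = S.avoiding e ∨ S.contract e = S.containing e) := by
  by_cases h : (S.containing e).Proper
  · rw [contract_eq_of_proper h]
    exact ⟨h, Or.inr rfl⟩
  · have : S.contract e = S.avoiding e := if_pos (not_not.1 (mt containing_proper.2 h))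
    rw [this]
    exact ⟨(avoiding_proper_or_containing_proper hS e).resolve_right h, Or.inl rfl⟩

theorem ThreeMinorStep.proper {S T : SetSystem α} (h : S.ThreeMinorStep T) (hS : S.Proper) :
    T.Proper := by
  obtain ⟨e, he, rfl | rfl | rfl⟩ := h
  exacts [(delete_spec hS e).1, (contract_spec hS e).1, (contract_spec (hS.loopCompl he) e).1]

theorem ThreeMinorStep.card_lt {S T : SetSystem α} (h : S.ThreeMinorStep T) (hS : S.Proper) :
    T.ground.card < S.ground.card := by
  obtain ⟨e, he, h⟩ := h
  have : T.ground = S.ground.erase e := by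
    rcases h with rfl | rfl | rfl
    · rcases (delete_spec hS e).2 with h | h <;> rw [h] <;> rfl
    · rcases (contract_spec hS e).2 with h | h <;> rw [h] <;> rfl
    · rcases (contract_spec (hS.loopCompl he) e).2 with h | h <;> rw [penrose, h] <;> rfl
  rw [this]
  exact Finset.card_erase_lt_of_mem he

theorem HasLagrangianRep.of_slice {S T : SetSystem α} (h : S.HasLagrangianRep) {e : α}
    (he : e ∈ S.ground) (hT : T.Proper ∧ (T = S.avoiding e ∨ T = S.containing e)) :
    T.HasLagrangianRep := by
  obtain ⟨hp, rfl | rfl⟩ := hT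
  exacts [h.avoiding hp, h.containing he hp]

theorem HasLagrangianRep.threeMinorStep {S T : SetSystem α} (h : S.HasLagrangianRep)
    (hS : S.Proper) (hST : S.ThreeMinorStep T) : T.HasLagrangianRep := by
  obtain ⟨e, he, rfl | rfl | rfl⟩ := hST
  · exact h.of_slice he (delete_spec hS e)
  · exact h.of_slice he (contract_spec hS e)
  · exact (h.loopCompl he).of_slice he (contract_spec (hS.loopCompl he) e)

theorem HasLagrangianRep.of_isThreeMinor {S T : SetSystem α} (h : S.HasLagrangianRep)
    (hS : S.Proper) (hST : S.IsThreeMinor T) : T.HasLagrangianRep ∧ T.Proper := by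
  induction hST with
  | refl => exact ⟨h, hS⟩
  | tail _ hstep ih => exact ⟨ih.1.threeMinorStep ih.2 hstep, hstep.proper ih.2⟩

end Binary

/-! ### Reconstruction from feasible sets of size at most two -/

section Reconstruction

variable {α : Type*} [DecidableEq α]

/-- The only candidate for a matrix `M` with `S = D(M)`: the entries are read off from the feasible
sets of size one and two, as `det M[{i, j}] = M i i * M j j + M i j` when `i ≠ j`. -/
def fundamentalMatrix (S : SetSystem α) : Matrix α α (ZMod 2) :=
  Matrix.of fun i j =>
    if i = j then (if {i} ∈ S.feasible then 1 else 0)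
    else (if {i, j} ∈ S.feasible then 1 else 0) +
      (if {i} ∈ S.feasible then 1 else 0) * (if {j} ∈ S.feasible then 1 else 0)

theorem fundamentalMatrix_isSymm (S : SetSystem α) : (fundamentalMatrix S).IsSymm := by
  ext i j
  by_cases h : i = j
  · subst h; rfl
  · simp only [fundamentalMatrix, Matrix.transpose_apply, Matrix.of_apply, h, Ne.symm h, if_false,
      Finset.pair_comm j i]
    rw [mul_comm]

theorem mem_iff_principalMinor_fundamentalMatrix {S : SetSystem α} (h0 : ∅ ∈ S.feasible)
    {X : Finset α} (hX : X.card ≤ 2) :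
    X ∈ S.feasible ↔ principalMinor (fundamentalMatrix S) X ≠ 0 := by
  interval_cases hc : X.card
  · rw [Finset.card_eq_zero] at hc
    simp [hc, h0, principalMinor_empty]
  · obtain ⟨i, rfl⟩ := Finset.card_eq_one.1 hc
    simp [principalMinor_singleton, fundamentalMatrix]
  · obtain ⟨i, j, hij, rfl⟩ := Finset.card_eq_two.1 hc
    rw [principalMinor_pair _ hij, (fundamentalMatrix_isSymm S).apply i j]
    simp only [fundamentalMatrix, Matrix.of_apply, hij, if_true, if_false]
    by_cases h1 : {i} ∈ S.feasible <;> by_cases h2 : {j} ∈ S.feasible <;>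
      by_cases h3 : {i, j} ∈ S.feasible <;> (simp [h1, h2, h3]; try decide)

/-- Principal minors of order at most two determine a symmetric matrix over the field with two
elements. -/
theorem apply_eq_of_principalMinor {M N : Matrix α α (ZMod 2)} (hM : M.IsSymm) (hN : N.IsSymm)
    {E : Finset α}
    (h : ∀ X ⊆ E, X.card ≤ 2 → (principalMinor M X ≠ 0 ↔ principalMinor N X ≠ 0)) :
    ∀ i ∈ E, ∀ j ∈ E, M i j = N i j := by
  have hdiag : ∀ i ∈ E, M i i = N i i := by
    intro i hi
    have := h {i} (by simpa) (by simp)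
    rw [principalMinor_singleton, principalMinor_singleton] at this
    generalize M i i = a, N i i = b at *
    decide +revert
  intro i hi j hj
  by_cases hij : i = j
  · subst hij; exact hdiag i hi
  · have := h {i, j} (by simp [Finset.insert_subset_iff, hi, hj]) (Finset.card_le_two)
    rw [principalMinor_pair _ hij, principalMinor_pair _ hij, hdiag i hi, hdiag j hj,
      hM.apply i j, hN.apply i j] at this
    generalize M i j = a, N i j = b, N i i = c, N j j = d at *
    decide +revert

theorem HasLagrangianRep.eq_of_card_le_two {S T : SetSystem α} (hS : S.HasLagrangianRep)
    (hT : T.HasLagrangianRep) (hg : S.ground = T.ground) (h0 : ∅ ∈ S.feasible)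
    (h : ∀ X : Finset α, X.card ≤ 2 → (X ∈ S.feasible ↔ X ∈ T.feasible)) : S = T := by
  obtain ⟨M, hM, hSM⟩ := hS.exists_isPrincipalRep h0
  obtain ⟨N, hN, hTN⟩ := hT.exists_isPrincipalRep ((h ∅ (by simp)).1 h0)
  rw [← hg] at hTN
  have hMN := apply_eq_of_principalMinor hM hN fun X hX hc =>
    (hSM X hX).symm.trans ((h X hc).trans (hTN X hX))
  refine ext_feasible hg fun X hX => ?_
  rw [hSM X hX, hTN X hX, principalMinor_congr fun i hi j hj => hMN i (hX hi) j (hX hj)]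

/-- The set system on `E` whose feasible sets are given by the principal minors of `M`. -/
def ofPrincipalMinors (E : Finset α) (M : Matrix α α (ZMod 2)) : SetSystem α where
  ground := E
  feasible := E.powerset.filter fun X => principalMinor M X ≠ 0
  subset_ground := fun _ hF => Finset.mem_powerset.1 (Finset.mem_filter.1 hF).1

theorem mem_ofPrincipalMinors {E : Finset α} {M : Matrix α α (ZMod 2)} {X : Finset α} :
    X ∈ (ofPrincipalMinors E M).feasible ↔ X ⊆ E ∧ principalMinor M X ≠ 0 := by
  simp [ofPrincipalMinors]

/-- Each of the three slices of `S` at each element of the ground set (the sets avoiding `e`; the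
sets containing `e`, with `e` removed; and the sets `X` for which exactly one of `X`, `X ∪ {e}` is
feasible) is representable unless it has no feasible set. -/
def SlicesRep (S : SetSystem α) : Prop :=
  ∀ e ∈ S.ground,
    ((S.avoiding e).Proper → (S.avoiding e).HasLagrangianRep) ∧
    ((S.containing e).Proper → (S.containing e).HasLagrangianRep) ∧
    (((S.loopCompl e).containing e).Proper → ((S.loopCompl e).containing e).HasLagrangianRep)

theorem SlicesRep.twist {S : SetSystem α} (h : S.SlicesRep) (A : Finset α) :
    (S.twist A).SlicesRep := by
  intro e he
  have he' : e ∈ S.ground := he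
  obtain ⟨h1, h2, h3⟩ := h e he
  rw [containing_loopCompl_twist he']
  by_cases heA : e ∈ A
  · rw [avoiding_twist_of_mem heA he', containing_twist_of_mem heA he']
    exact ⟨fun hp => (h2 (proper_twist_iff.1 hp)).twist A,
      fun hp => (h1 (proper_twist_iff.1 hp)).twist A,
      fun hp => (h3 (proper_twist_iff.1 hp)).twist A⟩
  · rw [avoiding_twist_of_notMem heA, containing_twist_of_notMem heA]
    exact ⟨fun hp => (h1 (proper_twist_iff.1 hp)).twist A,
      fun hp => (h2 (proper_twist_iff.1 hp)).twist A,
      fun hp => (h3 (proper_twist_iff.1 hp)).twist A⟩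

theorem HasLagrangianRep.slicesRep {S : SetSystem α} (h : S.HasLagrangianRep) : S.SlicesRep :=
  fun _ he => ⟨h.avoiding, h.containing he, (h.loopCompl he).containing he⟩

/-- Two set systems with representable slices and feasible empty set are equal if they agree on sets
of size at most two and the ground set has at least four elements. Deleting elements shows that they
agree on all proper subsets of the ground set `E`. One of the other two slices at `e` contains the
empty set, and it is determined by its feasible sets of size at most two, which come from sets of
size at most three and so are known; hence it decides whether `E` is feasible. -/
theorem SlicesRep.eq_of_card_le_two {S T : SetSystem α} (hS : S.SlicesRep) (hT : T.SlicesRep)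
    (hg : S.ground = T.ground) (hcard : 4 ≤ S.ground.card) (h0 : ∅ ∈ S.feasible)
    (h : ∀ X : Finset α, X.card ≤ 2 → (X ∈ S.feasible ↔ X ∈ T.feasible)) : S = T := by
  have h0T : ∅ ∈ T.feasible := (h ∅ (by simp)).1 h0
  have hsub : ∀ X : Finset α, X ≠ S.ground → (X ∈ S.feasible ↔ X ∈ T.feasible) := by
    intro X hX
    by_cases hXS : X ⊆ S.ground
    · obtain ⟨e, he, heX⟩ := Finset.exists_of_ssubset (hXS.ssubset_of_ne hX)
      have h0S' : ∅ ∈ (S.avoiding e).feasible := mem_avoiding.2 ⟨by simp, h0⟩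
      have h0T' : ∅ ∈ (T.avoiding e).feasible := mem_avoiding.2 ⟨by simp, h0T⟩
      have heq : S.avoiding e = T.avoiding e :=
        ((hS e he).1 ⟨_, h0S'⟩).eq_of_card_le_two ((hT e (hg ▸ he)).1 ⟨_, h0T'⟩)
          (by simp [avoiding, hg]) h0S' fun Y hY => by rw [mem_avoiding, mem_avoiding, h Y hY]
      have := congrArg (fun R => X ∈ R.feasible) heq
      simpa [mem_avoiding, heX] using this
    · exact iff_of_false (fun h => hXS (S.subset_ground X h))
        fun h => hXS (hg ▸ T.subset_ground X h)
  -- It remains to compare the ground set itself.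
  refine ext_feasible hg fun X hX => ?_
  by_cases hXE : X = S.ground
  swap
  · exact hsub X hXE
  obtain ⟨e, he⟩ : S.ground.Nonempty := Finset.card_pos.1 (by omega)
  have heT : e ∈ T.ground := hg ▸ he
  have hins : ∀ Y : Finset α, Y.card ≤ 2 → (insert e Y ∈ S.feasible ↔ insert e Y ∈ T.feasible) := by
    intro Y hY
    refine hsub _ fun heq => ?_
    have := Finset.card_insert_le e Y
    rw [heq] at this
    omega
  have hE : insert e (S.ground.erase e) = S.ground := Finset.insert_erase he
  have hE' : S.ground.erase e ∈ S.feasible ↔ S.ground.erase e ∈ T.feasible :=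
    hsub _ fun heq => Finset.notMem_erase e S.ground (heq.symm ▸ he)
  subst hXE
  -- The empty set lies in the slice of the sets containing `e` if `{e}` is feasible, and in the
  -- third slice otherwise.
  by_cases hes : {e} ∈ S.feasible
  · have h0S' : ∅ ∈ (S.containing e).feasible := mem_containing.2 ⟨by simp, by simpa⟩
    have h0T' : ∅ ∈ (T.containing e).feasible :=
      mem_containing.2 ⟨by simp, by simpa using (h {e} (by simp)).1 hes⟩
    have heq : S.containing e = T.containing e :=
      ((hS e he).2.1 ⟨_, h0S'⟩).eq_of_card_le_two ((hT e heT).2.1 ⟨_, h0T'⟩)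
        (by simp [containing, hg]) h0S' fun Y hY => by
          rw [mem_containing, mem_containing, hins Y hY]
    have := congrArg (fun R => S.ground.erase e ∈ R.feasible) heq
    simpa [mem_containing, hE] using this
  · have hmem : ∀ {R : SetSystem α}, e ∈ R.ground → ∅ ∈ R.feasible → {e} ∉ R.feasible →
        ∅ ∈ ((R.loopCompl e).containing e).feasible := fun he h0 hes =>
      (mem_containing_loopCompl he).2 ⟨by simp, Or.inr ⟨h0, by simpa using hes⟩⟩
    have h0S' := hmem he h0 hes
    have h0T' := hmem heT h0T (mt (h {e} (by simp)).2 hes)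
    have heq : (S.loopCompl e).containing e = (T.loopCompl e).containing e :=
      ((hS e he).2.2 ⟨_, h0S'⟩).eq_of_card_le_two ((hT e heT).2.2 ⟨_, h0T'⟩)
        (by simp [containing, loopCompl, hg]) h0S' fun Y hY => by
          rw [mem_containing_loopCompl he, mem_containing_loopCompl heT, hins Y hY, h Y hY]
    have := congrArg (fun R => S.ground.erase e ∈ R.feasible) heq
    simp only [mem_containing_loopCompl he, mem_containing_loopCompl heT, hE, hE',
      Finset.notMem_erase, not_false_eq_true, true_and, eq_iff_iff] at this
    by_cases hc : S.ground.erase e ∈ T.feasible <;> simp only [xor_def, hc] at this <;> tauto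

theorem ofPrincipalMinors_isPrincipalRep {E : Finset α} {M : Matrix α α (ZMod 2)} (hM : M.IsSymm) :
    (ofPrincipalMinors E M).IsPrincipalRep M :=
  ⟨hM, fun _ hX => mem_ofPrincipalMinors.trans (and_iff_right hX)⟩

/-- After a twist the empty set is feasible, and the set system is compared with the one of its
fundamental matrix. -/
theorem hasLagrangianRep_of_slicesRep {S : SetSystem α} (hS : S.Proper)
    (hcard : 4 ≤ S.ground.card) (h : S.SlicesRep) : S.HasLagrangianRep := by
  obtain ⟨A, hA⟩ := hS
  have h0 := empty_mem_twist hA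
  set W := S.twist A with hW
  have hT : (ofPrincipalMinors W.ground (fundamentalMatrix W)).HasLagrangianRep :=
    (ofPrincipalMinors_isPrincipalRep (fundamentalMatrix_isSymm W)).hasLagrangianRep
  have hWT : W = ofPrincipalMinors W.ground (fundamentalMatrix W) := by
    refine (h.twist A).eq_of_card_le_two hT.slicesRep rfl hcard h0 fun X hX => ?_
    rw [mem_ofPrincipalMinors, ← mem_iff_principalMinor_fundamentalMatrix h0 hX]
    exact ⟨fun h => ⟨W.subset_ground X h, h⟩, And.right⟩
  rw [← hWT] at hT
  rw [← twist_twist S A]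
  exact hT.twist A

end Reconstruction

/-! ### Transport along injections -/

section Transport

variable {α β : Type*}

/-- The injection `v` carries the set system `U` to `S`. -/
def Transports (v : β ↪ α) (S : SetSystem α) (U : SetSystem β) : Prop :=
  S.ground = U.ground.map v ∧ ∀ X, X.map v ∈ S.feasible ↔ X ∈ U.feasible

theorem Transports.iso {v : β ↪ α} {S : SetSystem α} {U : SetSystem β} (h : Transports v S U) :
    S.Iso U := by
  have hmem : ∀ b : U.ground, v b ∈ S.ground := fun b => h.1 ▸ Finset.mem_map_of_mem v b.2
  have hbij : Function.Bijective fun b : U.ground => (⟨v b, hmem b⟩ : S.ground) := by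
    constructor
    · intro a b hab
      exact Subtype.ext (v.injective (congrArg Subtype.val hab))
    · rintro ⟨a, ha⟩
      obtain ⟨b, hb, rfl⟩ := Finset.mem_map.1 (h.1 ▸ ha)
      exact ⟨⟨b, hb⟩, rfl⟩
  refine ⟨(Equiv.ofBijective _ hbij).symm, fun X => ?_⟩
  rw [← h.2]
  apply iff_of_eq
  congr 1
  rw [Finset.map_map, Finset.map_map]
  congr 1
  ext x
  exact (congrArg Subtype.val ((Equiv.ofBijective _ hbij).apply_symm_apply x)).symm

theorem Iso.exists_transports [DecidableEq β] {S : SetSystem α} {U : SetSystem β} [Fintype β]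
    (h : S.Iso U) (hU : U.ground = Finset.univ) : ∃ v, Transports v S U := by
  obtain ⟨f, hf⟩ := h
  have hmem : ∀ b, b ∈ U.ground := fun b => hU ▸ Finset.mem_univ b
  let v : β ↪ α := ⟨fun b => f.symm ⟨b, hmem b⟩, fun a b hab => by
    have := f.symm.injective (Subtype.ext hab)
    exact congrArg Subtype.val this⟩
  refine ⟨v, ?_, fun X => ?_⟩
  · ext a
    constructor
    · intro ha
      exact Finset.mem_map.2 ⟨f ⟨a, ha⟩, (f ⟨a, ha⟩).2,
        congrArg Subtype.val (f.symm_apply_apply ⟨a, ha⟩)⟩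
    · intro ha
      obtain ⟨b, -, rfl⟩ := Finset.mem_map.1 ha
      exact (f.symm ⟨b, hmem b⟩).2
  · have hX : (X.subtype (· ∈ U.ground)).map (Function.Embedding.subtype _) = X :=
      Finset.subtype_map_of_mem fun x _ => hmem x
    have key := hf ((X.subtype (· ∈ U.ground)).map f.symm.toEmbedding)
    rw [Finset.map_map, Finset.map_map, Finset.map_map] at key
    convert key using 2
    · conv_lhs => rw [← hX]
      rw [Finset.map_map]
      rfl
    · conv_lhs => rw [← hX]
      congr 1
      ext x
      exact congrArg Subtype.val (f.apply_symm_apply x).symm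

variable [DecidableEq α] [DecidableEq β]

theorem map_symmDiff (v : β ↪ α) (X Y : Finset β) :
    (symmDiff X Y).map v = symmDiff (X.map v) (Y.map v) := by
  simp only [Finset.map_eq_image]
  exact Finset.image_symmDiff _ _ v.injective

theorem Transports.twist {v : β ↪ α} {S : SetSystem α} {U : SetSystem β} (h : Transports v S U)
    (B : Finset β) : Transports v (S.twist (B.map v)) (U.twist B) := by
  refine ⟨h.1, fun X => ?_⟩
  rw [mem_twist, mem_twist, h.1, ← Finset.map_inter, ← map_symmDiff, h.2]

theorem Transports.loopCompl {v : β ↪ α} {S : SetSystem α} {U : SetSystem β}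
    (h : Transports v S U) {b : β} (hb : b ∈ U.ground) :
    Transports v (S.loopCompl (v b)) (U.loopCompl b) := by
  have hvb : v b ∈ S.ground := h.1 ▸ Finset.mem_map_of_mem v hb
  refine ⟨h.1, fun X => ?_⟩
  rw [mem_loopCompl hvb, mem_loopCompl hb, ← Finset.map_erase, h.2, h.2, Finset.mem_map']

/-- Twisted duals of `U` lift along an injection that carries `U` to `S`. -/
theorem Transports.exists_isTwistedDual_left {v : β ↪ α} {S : SetSystem α} {U U' : SetSystem β}
    (h : Transports v S U) (hU : U.IsTwistedDual U') :
    ∃ S', S.IsTwistedDual S' ∧ Transports v S' U' := by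
  induction hU with
  | refl => exact ⟨S, .refl, h⟩
  | tail _ hstep ih =>
    obtain ⟨S₁, hS, hv⟩ := ih
    rcases hstep with ⟨B, hB, rfl⟩ | ⟨b, hb, rfl⟩
    · exact ⟨_, hS.tail (Or.inl ⟨B.map v, hv.1 ▸ Finset.map_subset_map.2 hB, rfl⟩), hv.twist B⟩
    · exact ⟨_, hS.tail (Or.inr ⟨v b, hv.1 ▸ Finset.mem_map_of_mem v hb, rfl⟩), hv.loopCompl hb⟩

/-- Twisted duals of `S` descend along an injection that carries `U` to `S`. -/
theorem Transports.exists_isTwistedDual_right {v : β ↪ α} {S S' : SetSystem α} {U : SetSystem β}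
    (h : Transports v S U) (hS : S.IsTwistedDual S') :
    ∃ U', U.IsTwistedDual U' ∧ Transports v S' U' := by
  induction hS with
  | refl => exact ⟨U, .refl, h⟩
  | tail _ hstep ih =>
    obtain ⟨U₁, hU, hv⟩ := ih
    rcases hstep with ⟨A, hA, rfl⟩ | ⟨a, ha, rfl⟩
    · rw [hv.1] at hA
      obtain ⟨B, hB, rfl⟩ := Finset.subset_map_iff.1 hA
      exact ⟨_, hU.tail (Or.inl ⟨B, hB, rfl⟩), hv.twist B⟩
    · rw [hv.1] at ha
      obtain ⟨b, hb, rfl⟩ := Finset.mem_map.1 ha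
      exact ⟨_, hU.tail (Or.inr ⟨b, hb, rfl⟩), hv.loopCompl hb⟩

theorem isTwistedDual_ground {S T : SetSystem α} (h : S.IsTwistedDual T) : T.ground = S.ground := by
  induction h with
  | refl => rfl
  | tail _ hstep ih => rcases hstep with ⟨A, -, rfl⟩ | ⟨e, -, rfl⟩ <;> exact ih

end Transport

/-! ### Three elements -/

section Three

variable {α : Type*} [DecidableEq α]

/-- Loop complementations remove all feasible singletons while keeping the empty set feasible. -/
theorem exists_isTwistedDual_normalized {S : SetSystem α} (hS : S.Proper) :
    ∃ T, S.IsTwistedDual T ∧ ∅ ∈ T.feasible ∧ ∀ i, {i} ∉ T.feasible := by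
  have key : ∀ K ⊆ S.ground,
      ∃ T, S.IsTwistedDual T ∧ ∅ ∈ T.feasible ∧ ∀ i ∈ K, {i} ∉ T.feasible := by
    intro K
    induction K using Finset.induction_on with
    | empty =>
      intro _
      obtain ⟨A, hA⟩ := hS
      exact ⟨S.twist A, .single (Or.inl ⟨A, S.subset_ground A hA, rfl⟩), empty_mem_twist hA,
        by simp⟩
    | insert i K hi ih =>
      intro hK
      obtain ⟨T, hT, h0, hs⟩ := ih ((Finset.subset_insert _ _).trans hK)
      by_cases hiT : {i} ∈ T.feasible
      · have hiE : i ∈ T.ground := by simpa using T.subset_ground _ hiT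
        refine ⟨T.loopCompl i, hT.tail (Or.inr ⟨i, hiE, rfl⟩), ?_, fun j hj => ?_⟩
        · simp [mem_loopCompl hiE, xor_def, h0]
        · rw [mem_loopCompl hiE]
          rcases Finset.mem_insert.1 hj with rfl | hj
          · simp [hiT, h0]
          · have hij : i ≠ j := fun h => hi (h ▸ hj)
            simp [hs j hj, hij]
      · refine ⟨T, hT, h0, fun j hj => ?_⟩
        rcases Finset.mem_insert.1 hj with rfl | hj
        exacts [hiT, hs j hj]
  obtain ⟨T, hT, h0, hs⟩ := key S.ground subset_rfl
  refine ⟨T, hT, h0, fun i hi => hs i ?_ hi⟩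
  have := T.subset_ground _ hi
  rw [isTwistedDual_ground hT] at this
  simpa using this

/-- With empty set feasible and no feasible singletons, the representing matrix has zero diagonal,
so a set of three elements is not feasible. -/
theorem HasLagrangianRep.notMem_three {S : SetSystem α} (h : S.HasLagrangianRep) (v : Fin 3 ↪ α)
    (hv : S.ground = Finset.univ.map v) (h0 : ∅ ∈ S.feasible) (hs : ∀ i, {v i} ∉ S.feasible) :
    Finset.univ.map v ∉ S.feasible := by
  obtain ⟨M, hM, hrep⟩ := h.exists_isPrincipalRep h0
  rw [hrep _ hv.ge, not_not]
  refine principalMinor_three hM v fun i => ?_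
  have := hs i
  rwa [hrep _ (by simp [hv]), not_not, principalMinor_singleton] at this

/-- On at most three elements, the fundamental matrix represents a normalised set system except when
there are three elements and the whole ground set is feasible. -/
theorem exists_three_of_not_hasLagrangianRep {S : SetSystem α} (h : ¬ S.HasLagrangianRep)
    (hcard : S.ground.card ≤ 3) (h0 : ∅ ∈ S.feasible) (hs : ∀ i, {i} ∉ S.feasible) :
    ∃ v : Fin 3 ↪ α, S.ground = Finset.univ.map v ∧ S.ground ∈ S.feasible := by
  by_contra hcon
  refine h (IsPrincipalRep.hasLagrangianRep (M := fundamentalMatrix S)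
    ⟨fundamentalMatrix_isSymm S, fun X hX => ?_⟩)
  by_cases hc : X.card ≤ 2
  · exact mem_iff_principalMinor_fundamentalMatrix h0 hc
  have hXE : X = S.ground := Finset.eq_of_subset_of_card_le hX (by omega)
  subst hXE
  obtain ⟨a, b, c, hab, hac, hbc, hE⟩ := Finset.card_eq_three.1 (show S.ground.card = 3 by omega)
  have hinj : Function.Injective ![a, b, c] := by
    intro i j
    fin_cases i <;> fin_cases j <;> simp [hab, hac, hbc, hab.symm, hac.symm, hbc.symm]
  have hv : S.ground = Finset.univ.map ⟨![a, b, c], hinj⟩ := by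
    rw [hE]
    ext x
    simp [Fin.exists_fin_succ, eq_comm]
  refine iff_of_false (fun hmem => hcon ⟨_, hv, hmem⟩) (not_not.2 ?_)
  rw [hv]
  exact principalMinor_three (fundamentalMatrix_isSymm S) _ fun i => by
    simp [fundamentalMatrix, hs]

end Three

/-! ### Twisted duals of `B₁` and `S₃` -/

theorem isTwistedDual_twist {α : Type*} [DecidableEq α] {S T : SetSystem α} (h : S.IsTwistedDual T)
    (e : α) (he : e ∈ T.ground := by decide) : S.IsTwistedDual (T.twist {e}) :=
  h.tail (Or.inl ⟨{e}, by simpa, rfl⟩)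

theorem isTwistedDual_loopCompl {α : Type*} [DecidableEq α] {S T : SetSystem α}
    (h : S.IsTwistedDual T) (e : α) (he : e ∈ T.ground := by decide) :
    S.IsTwistedDual (T.loopCompl e) :=
  h.tail (Or.inr ⟨e, he, rfl⟩)

/-- In a normalised set system on three elements with feasible ground set only the three pairs are
free. All three pairs give `B₁`; the other seven choices give twisted duals of `S₃`. -/
theorem isTwistedDual_of_normalized {U : SetSystem (Fin 3)} (hg : U.ground = Finset.univ)
    (h0 : ∅ ∈ U.feasible) (hs : ∀ i, {i} ∉ U.feasible) (hE : Finset.univ ∈ U.feasible) :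
    B₁.IsTwistedDual U ∨ S₃.IsTwistedDual U := by
  have hall : ∀ X : Finset (Fin 3), X = ∅ ∨ (∃ i, X = {i}) ∨ X = {0, 1} ∨ X = {0, 2} ∨
      X = {1, 2} ∨ X = Finset.univ := by decide
  have hext : ∀ V : SetSystem (Fin 3), V.ground = Finset.univ → ∅ ∈ V.feasible →
      (∀ i, {i} ∉ V.feasible) → Finset.univ ∈ V.feasible →
      ({0, 1} ∈ V.feasible ↔ {0, 1} ∈ U.feasible) →
      ({0, 2} ∈ V.feasible ↔ {0, 2} ∈ U.feasible) →
      ({1, 2} ∈ V.feasible ↔ {1, 2} ∈ U.feasible) → V = U := by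
    intro V hgV h0V hsV hEV h01 h02 h12
    refine ext_feasible (hgV.trans hg.symm) fun X _ => ?_
    rcases hall X with rfl | ⟨i, rfl⟩ | rfl | rfl | rfl | rfl
    exacts [iff_of_true h0V h0, iff_of_false (hsV i) (hs i), h01, h02, h12, iff_of_true hEV hE]
  have h00 : S₃.IsTwistedDual S₃ := .refl
  by_cases h01 : {0, 1} ∈ U.feasible <;> by_cases h02 : {0, 2} ∈ U.feasible <;>
    by_cases h12 : {1, 2} ∈ U.feasible <;> simp only [h01, h02, h12, iff_true, iff_false] at hext
  · left
    rw [← hext B₁] <;> first | exact .refl | decide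
  · right
    have := isTwistedDual_twist (isTwistedDual_loopCompl (isTwistedDual_twist
      (isTwistedDual_loopCompl (isTwistedDual_loopCompl (isTwistedDual_twist h00 0) 0) 1) 1) 2) 2
    rw [← hext _ _ _ _ _ _ _ _]
    · exact this
    all_goals decide
  · right
    have := isTwistedDual_twist (isTwistedDual_loopCompl (isTwistedDual_loopCompl
      (isTwistedDual_twist (isTwistedDual_loopCompl (isTwistedDual_twist h00 1) 0) 0) 1) 2) 2
    rw [← hext _ _ _ _ _ _ _ _]
    · exact this
    all_goals decide
  · right
    have := isTwistedDual_twist (isTwistedDual_loopCompl (isTwistedDual_twist h00 2) 2) 2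
    rw [← hext _ _ _ _ _ _ _ _]
    · exact this
    all_goals decide
  · right
    have := isTwistedDual_loopCompl (isTwistedDual_twist (isTwistedDual_loopCompl
      (isTwistedDual_twist (isTwistedDual_loopCompl (isTwistedDual_twist h00 2) 0) 0) 1) 1) 2
    rw [← hext _ _ _ _ _ _ _ _]
    · exact this
    all_goals decide
  · right
    have := isTwistedDual_twist (isTwistedDual_loopCompl (isTwistedDual_twist h00 1) 1) 1
    rw [← hext _ _ _ _ _ _ _ _]
    · exact this
    all_goals decide
  · right
    have := isTwistedDual_twist (isTwistedDual_loopCompl (isTwistedDual_twist h00 0) 0) 0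
    rw [← hext _ _ _ _ _ _ _ _]
    · exact this
    all_goals decide
  · right
    rw [← hext S₃] <;> first | exact .refl | decide


/-! ### Excluded 3-minors -/

section ExcludedMinors

variable {α : Type*} [DecidableEq α]

/-- A representable set system is not isomorphic to a twisted dual of a set system on three elements
whose feasible sets include `∅` and the ground set but no singleton, such as `B₁` and `S₃`. -/
theorem HasLagrangianRep.false_of_iso {T : SetSystem α} (h : T.HasLagrangianRep)
    {U W : SetSystem (Fin 3)} (hTU : T.Iso U) (hWU : W.IsTwistedDual U)
    (hg : W.ground = Finset.univ) (h0 : ∅ ∈ W.feasible) (hs : ∀ i, {i} ∉ W.feasible)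
    (hE : Finset.univ ∈ W.feasible) : False := by
  obtain ⟨v, hv⟩ := hTU.exists_transports ((isTwistedDual_ground hWU).trans hg)
  obtain ⟨T', hT', hv'⟩ := hv.exists_isTwistedDual_left hWU.symm
  refine (h.of_isTwistedDual hT').notMem_three v (by rw [hv'.1, hg]) ?_ (fun i => ?_) ?_
  · rwa [← Finset.map_empty v, hv'.2]
  · rw [← Finset.map_singleton v, hv'.2]
    exact hs i
  · rwa [hv'.2]

theorem exists_iso_of_card_le_three {S : SetSystem α} (hS : S.Proper) (h : ¬ S.HasLagrangianRep)
    (hcard : S.ground.card ≤ 3) :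
    ∃ U : SetSystem (Fin 3), (B₁.IsTwistedDual U ∨ S₃.IsTwistedDual U) ∧ S.Iso U := by
  obtain ⟨T, hT, h0, hs⟩ := exists_isTwistedDual_normalized hS
  have hTrep : ¬ T.HasLagrangianRep := fun hrep => h (hrep.of_isTwistedDual hT.symm)
  obtain ⟨v, hv, hE⟩ := exists_three_of_not_hasLagrangianRep hTrep
    (by rwa [isTwistedDual_ground hT]) h0 hs
  let W : SetSystem (Fin 3) :=
    ⟨Finset.univ, Finset.univ.filter fun X => X.map v ∈ T.feasible, fun _ _ => Finset.subset_univ _⟩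
  have hW : Transports v T W := ⟨hv, fun X => by simp [W]⟩
  obtain ⟨U, hU, hSU⟩ := hW.exists_isTwistedDual_right hT.symm
  refine ⟨U, ?_, hSU.iso⟩
  have hdual := isTwistedDual_of_normalized (U := W) rfl ((hW.2 _).1 (by simpa))
    (fun i hi => hs (v i) (by simpa using (hW.2 _).2 hi)) ((hW.2 _).1 (hv ▸ hE))
  exact hdual.imp (fun h => h.trans hU) fun h => h.trans hU

/-- By induction all 3-minors by one element may be assumed representable. Then so are all slices,
which for at least four elements makes the set system itself representable. -/
theorem exists_threeMinor_of_not_hasLagrangianRep {S : SetSystem α} (hS : S.Proper)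
    (h : ¬ S.HasLagrangianRep) :
    ∃ T, S.IsThreeMinor T ∧
      ∃ U : SetSystem (Fin 3), (B₁.IsTwistedDual U ∨ S₃.IsTwistedDual U) ∧ T.Iso U := by
  induction hn : S.ground.card using Nat.strong_induction_on generalizing S with
  | _ n ih =>
    by_cases hcard : S.ground.card ≤ 3
    · exact ⟨S, .refl, exists_iso_of_card_le_three hS h hcard⟩
    by_contra hcon
    have hstep : ∀ T, S.ThreeMinorStep T → T.HasLagrangianRep := by
      intro T hT
      by_contra hrep
      obtain ⟨T', hT', hU⟩ := ih _ (hn ▸ hT.card_lt hS) (hT.proper hS) hrep rfl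
      exact hcon ⟨T', hT'.head hT, hU⟩
    refine h (hasLagrangianRep_of_slicesRep hS (by omega) fun e he => ⟨fun hp => ?_, fun hp => ?_,
      fun hp => ?_⟩)
    · rw [← delete_eq_of_proper hp]
      exact hstep _ ⟨e, he, Or.inl rfl⟩
    · rw [← contract_eq_of_proper hp]
      exact hstep _ ⟨e, he, Or.inr (Or.inl rfl)⟩
    · rw [← contract_eq_of_proper hp]
      exact hstep _ ⟨e, he, Or.inr (Or.inr rfl)⟩

end ExcludedMinors

end SetSystem

theorem mainTheorem5 {α : Type*} [DecidableEq α] (S : SetSystem α) (hS : S.Proper) :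
    S.IsBinaryDeltaMatroid ↔
      ¬ ∃ T : SetSystem α, S.IsThreeMinor T ∧
        ∃ U : SetSystem (Fin 3),
          (SetSystem.B₁.IsTwistedDual U ∨ SetSystem.S₃.IsTwistedDual U) ∧ T.Iso U := by
  rw [SetSystem.isBinaryDeltaMatroid_iff hS]
  constructor
  · rintro h ⟨T, hT, U, hU | hU, hTU⟩
    · exact (h.of_isThreeMinor hS hT).1.false_of_iso hTU hU rfl (by decide) (by decide) (by decide)
    · exact (h.of_isThreeMinor hS hT).1.false_of_iso hTU hU rfl (by decide) (by decide) (by decide)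
  · intro h
    by_contra hrep
    exact h (SetSystem.exists_threeMinor_of_not_hasLagrangianRep hS hrep)
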